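/- Let $A\in\mathbb{C}^{n\times n}$ and $u,v\in\mathbb{C}^n$, let $m_A$ be the minimal polynomial of $A$ and $l$ its degree, let $p_{uv}$ be the polynomial with $p_{uv}(\lambda)=m_A(\lambda)\,v^*(\lambda I_n-A)^{-1}u$ for every $\lambda\notin\sigma(A)$, and put $B(\tau)=A+\tau uv^*$ for $\tau\in\mathbb{C}$. Eigenvalues are counted with algebraic multiplicity, and $\tau\to\infty$ means $|\tau|\to\infty$ in $\mathbb{C}$. If $v^*A^ju=0$ for all $0\le j<l$, then $p_{uv}\equiv 0$ and $\sigma(B(\tau))=\sigma(A)$ for every $\tau\in\mathbb{C}$. If $\kappa\in\{0,\dots,l-1\}$ is such that $v^*A^ju=0$ for all $0\le j<\kappa$ and $v^*A^\kappa u\neq 0$, then the following hold. (i) $p_{uv}$ has degree exactly $l-\kappa-1$. (ii) Let $\zeta_1,\dots,\zeta_{l-\kappa-1}$ be the roots of $p_{uv}$, listed with multiplicity. For each $\tau$ one can choose $l-\kappa-1$ eigenvalues $\mu_1(\tau),\dots,\mu_{l-\kappa-1}(\tau)$ of $B(\tau)$ in such a way that $\mu_j(\tau)\to\zeta_j$ as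 $\tau\to\infty$, for every $j$. (iii) For all $\tau$ of sufficiently large modulus there are $\kappa+1$ distinct eigenvalues of $B(\tau)$ that are given by a convergent Puiseux expansion at $\tau=\infty$, $$\lambda(\tau)=c_{-1}\tau^{\frac1{\kappa+1}}+c_0+c_1\tau^{-\frac1{\kappa+1}}+\cdots,$$ one eigenvalue for each of the $\kappa+1$ complex values of $\tau^{\frac{1}{\kappa+1}}$. Here $c_{-1}$ may be taken to be any complex number with $c_{-1}^{\kappa+1}=v^*A^\kappa u$, and $$c_0=\frac1{\kappa+1}\cdot\frac{v^*A^{\kappa+1}u}{v^*A^\kappa u},\qquad c_1=\frac1{\kappa+1}\cdot\frac1{(v^*A^\kappa u)\,c_{-1}}\left(v^*A^{\kappa+2}u-\frac{\kappa+2}{2(\kappa+1)}\cdot\frac{(v^*A^{\kappa+1}u)^2}{v^*A^\kappa u}\right).$$ (iv) Let $\zeta$ be a root of $p_{uv}$ of multiplicity $k$ that is not a root of $m_A$, and put $a_m=v^*(\zeta I_n-A)^{-m}u$ for $m\ge0$. Then $a_{k+1}\neq0$, and for all $\tau$ of sufficiently large modulus there are $k$ distinct eigenvalues of $B(\tau)$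 that converge to $\zeta$ as $\tau\to\infty$ and are given by a convergent Puiseux expansion at $\tau=\infty$, $$\lambda(\tau)=\zeta-b_1\tau^{-\frac1k}-b_2\tau^{-\frac2k}-b_3\tau^{-\frac3k}-\cdots,$$ one eigenvalue for each of the $k$ complex values of $\tau^{\frac1k}$. Here $b_1$ may be taken to be any complex number with $b_1^k=a_{k+1}^{-1}$, and $b_2=-\frac1k\cdot\frac{b_1^2\,a_{k+2}}{a_{k+1}}$. -/

import Mathlib

open Polynomial Filter Topology
open scoped Matrix

/-- The scalar `v^* M u`. -/
noncomputable def sesq {n : ℕ} (u v : Fin n → ℂ) (M : Matrix (Fin n) (Fin n) ℂ) : ℂ :=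
  star v ⬝ᵥ (M *ᵥ u)

/-- The perturbed matrix `B(τ) = A + τ u v^*`. -/
noncomputable def perturbed {n : ℕ} (A : Matrix (Fin n) (Fin n) ℂ) (u v : Fin n → ℂ) (τ : ℂ) :
    Matrix (Fin n) (Fin n) ℂ :=
  A + τ • Matrix.vecMulVec u (star v)

/-- There is exactly one polynomial that agrees with `m_A(z) v^* (z I - A)⁻¹ u`
at every `z` which is not an eigenvalue of `A`. -/
theorem existsUnique_puv {n : ℕ} (A : Matrix (Fin n) (Fin n) ℂ) (u v : Fin n → ℂ) :
    ∃! p : ℂ[X], ∀ z : ℂ, z ∉ spectrum ℂ A →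
      p.eval z = (minpoly ℂ A).eval z * sesq u v (z • (1 : Matrix (Fin n) (Fin n) ℂ) - A)⁻¹ := by
  set m := minpoly ℂ A with hm
  refine existsUnique_of_exists_of_unique ⟨∑ j ∈ Finset.range (m.natDegree + 1), ∑ i ∈ Finset.range j,
    C (m.coeff j * sesq u v (A ^ (j - 1 - i))) * X ^ i, ?_⟩ ?_
  · intro z hz
    have hu : IsUnit (z • (1 : Matrix (Fin n) (Fin n) ℂ) - A) := by
      have h := spectrum.notMem_iff.mp hz
      rwa [Algebra.algebraMap_eq_smul_one] at h
    have hdet := (Matrix.isUnit_iff_isUnit_det _).mp hu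
    have hc : Commute (z • (1 : Matrix (Fin n) (Fin n) ℂ)) A :=
      (Commute.one_left A).smul_left z
    have key : (∑ j ∈ Finset.range (m.natDegree + 1), m.coeff j •
        ∑ i ∈ Finset.range j, (z • (1 : Matrix (Fin n) (Fin n) ℂ)) ^ i * A ^ (j - 1 - i)) *
        (z • (1 : Matrix (Fin n) (Fin n) ℂ) - A) = m.eval z • 1 := by
      rw [Finset.sum_mul]
      simp only [smul_mul_assoc, hc.geom_sum₂_mul, smul_sub]
      rw [Finset.sum_sub_distrib, ← Polynomial.aeval_eq_sum_range (p := m) A, hm, minpoly.aeval, sub_zero,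
        ← hm, Polynomial.eval_eq_sum_range, Finset.sum_smul]
      refine Finset.sum_congr rfl fun j _ => ?_
      rw [_root_.smul_pow, one_pow, smul_smul]
    have key2 : m.eval z • (z • (1 : Matrix (Fin n) (Fin n) ℂ) - A)⁻¹ =
        ∑ j ∈ Finset.range (m.natDegree + 1), m.coeff j •
        ∑ i ∈ Finset.range j, (z • (1 : Matrix (Fin n) (Fin n) ℂ)) ^ i * A ^ (j - 1 - i) := by
      rw [← Matrix.mul_nonsing_inv_cancel_right _
        (∑ j ∈ Finset.range (m.natDegree + 1), m.coeff j •
        ∑ i ∈ Finset.range j, (z • (1 : Matrix (Fin n) (Fin n) ℂ)) ^ i * A ^ (j - 1 - i)) hdet,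
        key, smul_mul_assoc, one_mul]
    have key3 : m.eval z * sesq u v (z • (1 : Matrix (Fin n) (Fin n) ℂ) - A)⁻¹ =
        sesq u v (m.eval z • (z • (1 : Matrix (Fin n) (Fin n) ℂ) - A)⁻¹) := by
      simp [sesq, Matrix.smul_mulVec]
    rw [key3, key2]
    simp only [sesq, Matrix.sum_mulVec, Matrix.smul_mulVec, dotProduct_sum, dotProduct_smul,
      Polynomial.eval_finsetSum, _root_.smul_pow, one_pow, smul_mul_assoc, one_mul, smul_eq_mul,
      Polynomial.eval_mul, Polynomial.eval_C, Polynomial.eval_pow, Polynomial.eval_X,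
      Finset.mul_sum]
    refine Finset.sum_congr rfl fun j _ => Finset.sum_congr rfl fun i _ => ?_
    ring
  · intro p q hp hq
    refine Polynomial.eq_of_infinite_eval_eq _ _
      ((Matrix.finite_spectrum A).infinite_compl.mono fun z hz => ?_)
    exact (hp z hz).trans (hq z hz).symm

/-- The polynomial `p_{uv}(z) = v^* m_A(z) (z I - A)⁻¹ u`. -/
noncomputable def puv {n : ℕ} (A : Matrix (Fin n) (Fin n) ℂ) (u v : Fin n → ℂ) : ℂ[X] :=
  (existsUnique_puv A u v).choose

theorem puv_eval {n : ℕ} (A : Matrix (Fin n) (Fin n) ℂ) (u v : Fin n → ℂ) (z : ℂ)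
    (hz : z ∉ spectrum ℂ A) :
    (puv A u v).eval z =
      (minpoly ℂ A).eval z * sesq u v (z • (1 : Matrix (Fin n) (Fin n) ℂ) - A)⁻¹ :=
  (existsUnique_puv A u v).choose_spec.1 z hz

/-- The functions `τ ↦ ∑ m, c m * s ^ (e - m)`, where `s` runs through the `d` complex
`d`-th roots of `τ`, are `d` distinct eigenvalues of `B τ` for all `τ` of large modulus:
the expansion `c₀ τ^{e/d} + c₁ τ^{(e-1)/d} + ⋯` is a convergent Puiseux expansion at `τ = ∞` of
`d` eigenvalues of `B τ`. Here `L s` is the sum of the series at the root `s`, and eigenvalues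
are counted with algebraic multiplicity. -/
def IsPuiseuxExpansion {n : ℕ} (B : ℂ → Matrix (Fin n) (Fin n) ℂ) (d : ℕ) (e : ℤ)
    (c : ℕ → ℂ) (L : ℂ → ℂ) : Prop :=
  ∃ R : ℝ, 0 < R ∧
    (∀ s : ℂ, R < ‖s‖ → HasSum (fun m : ℕ => c m * s ^ (e - (m : ℤ))) (L s)) ∧
    ∀ τ : ℂ, R ^ d < ‖τ‖ →
      (nthRoots d τ).card = d ∧ ((nthRoots d τ).map L).Nodup ∧
        (nthRoots d τ).map L ≤ (B τ).charpoly.roots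

/-! By the matrix determinant lemma, `det (z I - B(τ)) = det (z I - A) (1 - τ v^* (z I - A)⁻¹ u)`,
so the characteristic polynomial of `B(τ)` is that of `A` with its factor `m_A` replaced by
`m_A - τ p_{uv}` (`exists_charpoly_perturbed_eq`). Synthetic division expresses the coefficients
of `p_{uv}` through the moments `v^* A ^ j u` (`coeff_puv`), which gives its degree, and its
vanishing when all moments below `deg m_A` vanish.

As `τ → ∞`, the polynomials `p_{uv} - τ⁻¹ m_A` tend to `p_{uv}` coefficientwise, and their bounded
roots tend to those of `p_{uv}`, even though the degree drops in the limit. This form of continuity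
of roots (`exists_roots_tendsto`) is proved by splitting off one root at a time: if all roots of
`f` are far from `a`, then `f` is small near `a` as soon as it is small at `a`.

Both Puiseux expansions come from the secular equation `τ v^* (z I - A)⁻¹ u = 1`. In the
coordinate `y = 1 / z` at infinity, or `w = ζ - z` at a root `ζ` of `p_{uv}`, it becomes
`y ^ d F y = t ^ d`, where `t ^ d = 1 / τ` and `F` is a generating function of moments with
`F 0 ≠ 0` (`momentGen`). Taking an analytic `d`-th root of `F` and inverting
`y ↦ y F(y) ^ (1 / d)` solves it by `y = t / M t` with `M` analytic and `M ^ d = F (t / M)`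
(`exists_analyticAt_pow_eq`); logarithmic differentiation of this equation gives the first
coefficients. Distinct `t` give distinct `y`, hence distinct eigenvalues. -/

/-! ### The polynomial `p_{uv}` and the characteristic polynomial of `B(τ)` -/

theorem sesq_add {n : ℕ} (u v : Fin n → ℂ) (M N : Matrix (Fin n) (Fin n) ℂ) :
    sesq u v (M + N) = sesq u v M + sesq u v N := by
  simp [sesq, Matrix.add_mulVec, dotProduct_add]

theorem sesq_smul {n : ℕ} (u v : Fin n → ℂ) (a : ℂ) (M : Matrix (Fin n) (Fin n) ℂ) :
    sesq u v (a • M) = a * sesq u v M := by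
  simp [sesq, Matrix.smul_mulVec]

theorem sesq_sum {n : ℕ} (u v : Fin n → ℂ) {ι : Type*} (s : Finset ι)
    (M : ι → Matrix (Fin n) (Fin n) ℂ) :
    sesq u v (∑ i ∈ s, M i) = ∑ i ∈ s, sesq u v (M i) := by
  simp [sesq, Matrix.sum_mulVec, dotProduct_sum]

theorem isUnit_det_of_notMem_spectrum {n : ℕ} {A : Matrix (Fin n) (Fin n) ℂ} {z : ℂ}
    (hz : z ∉ spectrum ℂ A) : IsUnit (z • (1 : Matrix (Fin n) (Fin n) ℂ) - A).det := by
  have h := spectrum.notMem_iff.mp hz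
  rw [Algebra.algebraMap_eq_smul_one] at h
  exact (Matrix.isUnit_iff_isUnit_det _).mp h

/-- Synthetic division of `m_A(z) I = m_A(z) I - m_A(A)` by `z I - A` gives the coefficients of
`p_{uv}` in terms of those of `m_A` and of the moments `v^* A ^ j u`. -/
theorem puv_eq_sum {n : ℕ} (A : Matrix (Fin n) (Fin n) ℂ) (u v : Fin n → ℂ) :
    puv A u v = ∑ j ∈ Finset.range ((minpoly ℂ A).natDegree + 1), ∑ i ∈ Finset.range j,
      C ((minpoly ℂ A).coeff j * sesq u v (A ^ (j - 1 - i))) * X ^ i := by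
  set m := minpoly ℂ A with hm
  refine (existsUnique_puv A u v).unique (puv_eval A u v) fun z hz => ?_
  have hdet := isUnit_det_of_notMem_spectrum hz
  have hc : Commute (z • (1 : Matrix (Fin n) (Fin n) ℂ)) A := (Commute.one_left A).smul_left z
  have key : (∑ j ∈ Finset.range (m.natDegree + 1), m.coeff j •
      ∑ i ∈ Finset.range j, (z • (1 : Matrix (Fin n) (Fin n) ℂ)) ^ i * A ^ (j - 1 - i)) *
      (z • (1 : Matrix (Fin n) (Fin n) ℂ) - A) = m.eval z • 1 := by
    rw [Finset.sum_mul]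
    simp only [smul_mul_assoc, hc.geom_sum₂_mul, smul_sub]
    rw [Finset.sum_sub_distrib, ← Polynomial.aeval_eq_sum_range (p := m) A, hm, minpoly.aeval,
      sub_zero, ← hm, Polynomial.eval_eq_sum_range, Finset.sum_smul]
    simp [_root_.smul_pow, smul_smul]
  have key2 : m.eval z • (z • (1 : Matrix (Fin n) (Fin n) ℂ) - A)⁻¹ =
      ∑ j ∈ Finset.range (m.natDegree + 1), m.coeff j •
      ∑ i ∈ Finset.range j, (z • (1 : Matrix (Fin n) (Fin n) ℂ)) ^ i * A ^ (j - 1 - i) := by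
    rw [← Matrix.mul_nonsing_inv_cancel_right _ (∑ j ∈ Finset.range (m.natDegree + 1),
      m.coeff j • ∑ i ∈ Finset.range j, _) hdet, key, smul_mul_assoc, one_mul]
  rw [← hm, ← sesq_smul, key2]
  simp only [sesq_sum, sesq_smul, Polynomial.eval_finsetSum, _root_.smul_pow, one_pow,
    smul_mul_assoc, one_mul, Polynomial.eval_mul, Polynomial.eval_C, Polynomial.eval_pow,
    Polynomial.eval_X, Finset.mul_sum]
  exact Finset.sum_congr rfl fun j _ => Finset.sum_congr rfl fun i _ => by ring

theorem coeff_puv {n : ℕ} (A : Matrix (Fin n) (Fin n) ℂ) (u v : Fin n → ℂ) (i : ℕ) :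
    (puv A u v).coeff i = ∑ j ∈ Finset.range ((minpoly ℂ A).natDegree + 1),
      if i < j then (minpoly ℂ A).coeff j * sesq u v (A ^ (j - 1 - i)) else 0 := by
  rw [puv_eq_sum]
  simp only [finsetSum_coeff, coeff_C_mul, coeff_X_pow, mul_ite, mul_one, mul_zero,
    Finset.sum_ite_eq, Finset.mem_range]

theorem puv_eq_zero {n : ℕ} {A : Matrix (Fin n) (Fin n) ℂ} {u v : Fin n → ℂ}
    (h : ∀ j < (minpoly ℂ A).natDegree, sesq u v (A ^ j) = 0) : puv A u v = 0 := by
  ext i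
  rw [coeff_puv, coeff_zero]
  refine Finset.sum_eq_zero fun j hj => ?_
  rw [Finset.mem_range] at hj
  split_ifs with hij
  · rw [h _ (by omega), mul_zero]
  · rfl

theorem degree_puv {n : ℕ} {A : Matrix (Fin n) (Fin n) ℂ} {u v : Fin n → ℂ} {κ : ℕ}
    (hκ : κ < (minpoly ℂ A).natDegree) (h : ∀ j < κ, sesq u v (A ^ j) = 0)
    (h' : sesq u v (A ^ κ) ≠ 0) :
    (puv A u v).degree = (((minpoly ℂ A).natDegree - κ - 1 : ℕ) : WithBot ℕ) := by
  have hmon : (minpoly ℂ A).coeff (minpoly ℂ A).natDegree = 1 :=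
    minpoly.monic (Matrix.isIntegral A)
  apply le_antisymm
  · rw [degree_le_iff_coeff_zero]
    intro i hi
    rw [Nat.cast_lt] at hi
    rw [coeff_puv]
    refine Finset.sum_eq_zero fun j hj => ?_
    rw [Finset.mem_range] at hj
    split_ifs with hij
    · rw [h _ (by omega), mul_zero]
    · rfl
  · apply le_degree_of_ne_zero
    rw [coeff_puv, Finset.sum_eq_single (minpoly ℂ A).natDegree]
    · rw [if_pos (by omega), hmon, one_mul]
      convert h' using 3
      omega
    · intro j hj hj'
      rw [Finset.mem_range] at hj
      split_ifs with hij
      · rw [h _ (by omega), mul_zero]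
      · rfl
    · simp

/-- The matrix determinant lemma for `z I - B(τ)`. -/
theorem eval_charpoly_perturbed {n : ℕ} (A : Matrix (Fin n) (Fin n) ℂ) (u v : Fin n → ℂ)
    (τ : ℂ) {z : ℂ} (hz : IsUnit (z • (1 : Matrix (Fin n) (Fin n) ℂ) - A).det) :
    (perturbed A u v τ).charpoly.eval z = A.charpoly.eval z *
      (1 - τ * sesq u v (z • (1 : Matrix (Fin n) (Fin n) ℂ) - A)⁻¹) := by
  have hs : Matrix.scalar (Fin n) z = z • (1 : Matrix (Fin n) (Fin n) ℂ) :=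
    (Matrix.smul_one_eq_diagonal z).symm
  rw [Matrix.eval_charpoly, Matrix.eval_charpoly, perturbed, hs]
  have h1 : z • (1 : Matrix (Fin n) (Fin n) ℂ) - (A + τ • Matrix.vecMulVec u (star v)) =
      (z • 1 - A) + Matrix.replicateCol Unit (-τ • u) * Matrix.replicateRow Unit (star v) := by
    rw [← Matrix.vecMulVec_eq, Matrix.smul_vecMulVec, neg_smul]
    abel
  rw [h1, Matrix.det_add_replicateCol_mul_replicateRow hz]
  congr 1
  rw [Matrix.det_unique, Matrix.add_apply, Matrix.one_apply_eq, Matrix.mul_assoc,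
    ← Matrix.replicateCol_mulVec]
  change 1 + star v ⬝ᵥ ((z • 1 - A)⁻¹ *ᵥ (-τ • u)) = _
  rw [Matrix.mulVec_smul, dotProduct_smul, sesq, smul_eq_mul]
  ring

/-- The characteristic polynomial of `B(τ)` is obtained from that of `A` by replacing the factor
`m_A` with `m_A - τ p_{uv}`. -/
theorem exists_charpoly_perturbed_eq {n : ℕ} (A : Matrix (Fin n) (Fin n) ℂ) (u v : Fin n → ℂ) :
    ∃ q : ℂ[X], A.charpoly = minpoly ℂ A * q ∧
      ∀ τ, (perturbed A u v τ).charpoly = (minpoly ℂ A - C τ * puv A u v) * q := by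
  obtain ⟨q, hq⟩ := Matrix.minpoly_dvd_charpoly A
  refine ⟨q, hq, fun τ => Polynomial.eq_of_infinite_eval_eq _ _
    ((Matrix.finite_spectrum A).infinite_compl.mono fun z hz => ?_)⟩
  change _ = _
  rw [eval_charpoly_perturbed A u v τ (isUnit_det_of_notMem_spectrum hz), hq]
  simp only [eval_mul, eval_sub, eval_C, puv_eval A u v z hz]
  ring

theorem spectrum_perturbed_of_puv_eq_zero {n : ℕ} {A : Matrix (Fin n) (Fin n) ℂ}
    {u v : Fin n → ℂ} (h : puv A u v = 0) (τ : ℂ) :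
    spectrum ℂ (perturbed A u v τ) = spectrum ℂ A := by
  obtain ⟨q, hq, hB⟩ := exists_charpoly_perturbed_eq A u v
  ext z
  rw [Matrix.mem_spectrum_iff_isRoot_charpoly, Matrix.mem_spectrum_iff_isRoot_charpoly, hB, hq, h,
    mul_zero, sub_zero]

/-! ### Continuity of roots -/

/-- If every root of `f` has distance at least `‖z - a‖` from `a`, then
`‖z - r‖ ≤ 2 ‖a - r‖` for every root `r`. -/
theorem norm_eval_le_of_roots_far {f : ℂ[X]} {N : ℕ} (hN : f.natDegree ≤ N) {a z : ℂ}
    (h : ∀ r ∈ f.roots, ‖z - a‖ ≤ ‖a - r‖) : ‖f.eval z‖ ≤ 2 ^ N * ‖f.eval a‖ := by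
  have hs := IsAlgClosed.splits f
  have key : ∀ s : Multiset ℂ, (∀ r ∈ s, ‖z - a‖ ≤ ‖a - r‖) →
      ‖(s.map (z - ·)).prod‖ ≤ 2 ^ s.card * ‖(s.map (a - ·)).prod‖ := by
    intro s
    induction s using Multiset.induction_on with
    | empty => simp
    | cons r s ih =>
      intro hr
      have h1 := ih fun x hx => hr x (Multiset.mem_cons_of_mem hx)
      have h2 := hr r (Multiset.mem_cons_self r s)
      have h3 : ‖z - r‖ ≤ 2 * ‖a - r‖ := by
        have : ‖z - r‖ ≤ ‖z - a‖ + ‖a - r‖ := norm_sub_le_norm_sub_add_norm_sub z a r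
        linarith
      simp only [Multiset.map_cons, Multiset.prod_cons, Multiset.card_cons, norm_mul, pow_succ]
      calc _ ≤ (2 * ‖a - r‖) * (2 ^ s.card * ‖(s.map (a - ·)).prod‖) := by gcongr
        _ = _ := by ring
  rw [hs.eval_eq_prod_roots, hs.eval_eq_prod_roots, norm_mul, norm_mul]
  calc _ ≤ ‖f.leadingCoeff‖ * (2 ^ f.roots.card * ‖(f.roots.map (a - ·)).prod‖) := by
        gcongr; exact key _ h
    _ ≤ ‖f.leadingCoeff‖ * (2 ^ N * ‖(f.roots.map (a - ·)).prod‖) := by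
        rw [← hs.natDegree_eq_card_roots]; gcongr; norm_num
    _ = _ := by ring

section RootContinuity

variable {α : Type*} {F : Filter α} {f : α → ℂ[X]} {p : ℂ[X]} {N : ℕ}

theorem tendsto_eval_of_tendsto_coeff (hN : ∀ t, (f t).natDegree ≤ N)
    (hpN : p.natDegree ≤ N) (hf : ∀ i, Tendsto (fun t => (f t).coeff i) F (𝓝 (p.coeff i)))
    (z : ℂ) : Tendsto (fun t => (f t).eval z) F (𝓝 (p.eval z)) := by
  simp_rw [fun t => eval_eq_sum_range' (Nat.lt_succ_of_le (hN t)) z,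
    eval_eq_sum_range' (Nat.lt_succ_of_le hpN) z]
  exact tendsto_finsetSum _ fun i _ => (hf i).mul_const _

/-- Since the leading coefficient of `p` need not be the limit of those of `f t`, some roots of
`f t` may escape to infinity, but each root of `p` attracts a root of `f t`. -/
theorem eventually_exists_root_near (hp : p ≠ 0) (hN : ∀ t, (f t).natDegree ≤ N)
    (hpN : p.natDegree ≤ N) (hf : ∀ i, Tendsto (fun t => (f t).coeff i) F (𝓝 (p.coeff i)))
    {a : ℂ} (ha : p.IsRoot a) {ε : ℝ} (hε : 0 < ε) :
    ∀ᶠ t in F, ∃ r ∈ (f t).roots, ‖a - r‖ < ε := by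
  obtain ⟨z, hz, hpz⟩ : ∃ z ∈ Metric.ball a ε, p.eval z ≠ 0 := by
    by_contra! h
    refine hp (eq_zero_of_infinite_isRoot p (Set.Infinite.mono h ?_))
    exact infinite_of_mem_nhds a (Metric.ball_mem_nhds a hε)
  have h1 := (tendsto_eval_of_tendsto_coeff hN hpN hf z).norm
  have h2 := ((tendsto_eval_of_tendsto_coeff hN hpN hf a).norm).const_mul ((2 : ℝ) ^ N)
  rw [ha.eq_zero, norm_zero, mul_zero] at h2
  filter_upwards [h2.eventually_lt h1 (norm_pos_iff.mpr hpz)] with t ht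
  by_contra! hfar
  refine ht.not_ge (norm_eval_le_of_roots_far (hN t) fun r hr => le_trans ?_ (hfar r hr))
  exact (mem_ball_iff_norm.mp hz).le

theorem exists_root_tendsto (hp : p ≠ 0) (hN : ∀ t, (f t).natDegree ≤ N)
    (hpN : p.natDegree ≤ N) (hf : ∀ i, Tendsto (fun t => (f t).coeff i) F (𝓝 (p.coeff i)))
    {a : ℂ} (ha : p.IsRoot a) :
    ∃ r : α → ℂ, (∀ᶠ t in F, r t ∈ (f t).roots) ∧ Tendsto r F (𝓝 a) := by
  classical
  -- a root nearest to `a` serves for every `ε` at once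
  have hmin : ∀ t, ∃ r, (f t).roots ≠ 0 →
      r ∈ (f t).roots ∧ ∀ x ∈ (f t).roots, ‖a - r‖ ≤ ‖a - x‖ := by
    intro t
    by_cases h : (f t).roots = 0
    · exact ⟨0, fun h' => absurd h h'⟩
    · obtain ⟨x, hx⟩ := Multiset.exists_mem_of_ne_zero h
      obtain ⟨r, hr, hr'⟩ := (f t).roots.toFinset.exists_min_image (fun r => ‖a - r‖)
        ⟨x, Multiset.mem_toFinset.mpr hx⟩
      exact ⟨r, fun _ => ⟨Multiset.mem_toFinset.mp hr,
        fun y hy => hr' y (Multiset.mem_toFinset.mpr hy)⟩⟩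
  choose r hr using hmin
  refine ⟨r, ?_, ?_⟩
  · filter_upwards [eventually_exists_root_near hp hN hpN hf ha one_pos] with t ⟨x, hx, _⟩
    exact (hr t fun h => by simp [h] at hx).1
  · rw [Metric.tendsto_nhds]
    intro ε hε
    filter_upwards [eventually_exists_root_near hp hN hpN hf ha hε] with t ⟨x, hx, hxε⟩
    rw [dist_comm, dist_eq_norm]
    exact ((hr t fun h => by simp [h] at hx).2 x hx).trans_lt hxε

theorem natDegree_divByMonic_X_sub_C_le {g : ℂ[X]} (b : ℂ) (hg : g.natDegree ≤ N) :
    (g /ₘ (X - C b)).natDegree ≤ N := by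
  rw [natDegree_divByMonic g (monic_X_sub_C b)]
  omega

theorem tendsto_coeff_divByMonic (hN : ∀ t, (f t).natDegree ≤ N)
    (hpN : p.natDegree ≤ N) (hf : ∀ i, Tendsto (fun t => (f t).coeff i) F (𝓝 (p.coeff i)))
    {a : ℂ} {r : α → ℂ} (hr : Tendsto r F (𝓝 a)) (i : ℕ) :
    Tendsto (fun t => (f t /ₘ (X - C (r t))).coeff i) F (𝓝 ((p /ₘ (X - C a)).coeff i)) := by
  induction hk : N + 1 - i generalizing i with
  | zero =>
    rw [coeff_eq_zero_of_natDegree_lt ((natDegree_divByMonic_X_sub_C_le a hpN).trans_lt (by omega))]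
    simp_rw [fun t => coeff_eq_zero_of_natDegree_lt
      ((natDegree_divByMonic_X_sub_C_le (r t) (hN t)).trans_lt (by omega : N < i))]
    exact tendsto_const_nhds
  | succ k ih =>
    rw [coeff_divByMonic_X_sub_C_rec]
    simp_rw [fun t => coeff_divByMonic_X_sub_C_rec (f t) (r t) i]
    exact (hf (i + 1)).add (hr.mul (ih (i + 1) (by omega)))

/-- Continuity of the roots under coefficientwise convergence with bounded degrees: the roots of
the limit `p`, with multiplicity, are the limits of `p.roots.card` roots of `f t`. -/
theorem exists_roots_tendsto {d : ℕ} (hp : p ≠ 0) (hd : p.roots.card = d)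
    (hN : ∀ t, (f t).natDegree ≤ N) (hpN : p.natDegree ≤ N)
    (hf : ∀ i, Tendsto (fun t => (f t).coeff i) F (𝓝 (p.coeff i))) :
    ∃ (ζ : Fin d → ℂ) (μ : Fin d → α → ℂ), Finset.univ.val.map ζ = p.roots ∧
      (∀ᶠ t in F, Finset.univ.val.map (fun j => μ j t) ≤ (f t).roots) ∧
      ∀ j, Tendsto (μ j) F (𝓝 (ζ j)) := by
  induction d generalizing f p with
  | zero =>
    refine ⟨Fin.elim0, Fin.elim0, ?_, ?_, fun j => j.elim0⟩
    · rw [Multiset.card_eq_zero.mp hd]; simp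
    · simp
  | succ d ih =>
    obtain ⟨a, ha⟩ := Multiset.exists_mem_of_ne_zero
      (show p.roots ≠ 0 from fun h => by simp [h] at hd)
    have ha' : p.IsRoot a := isRoot_of_mem_roots ha
    obtain ⟨r, hr, hra⟩ := exists_root_tendsto hp hN hpN hf ha'
    have hpa : (X - C a) * (p /ₘ (X - C a)) = p := mul_divByMonic_eq_iff_isRoot.mpr ha'
    have hp' : p /ₘ (X - C a) ≠ 0 := fun h => hp (by rw [← hpa, h, mul_zero])
    have hroots : p.roots = a ::ₘ (p /ₘ (X - C a)).roots := by
      conv_lhs => rw [← hpa]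
      rw [roots_mul (by rwa [hpa]), roots_X_sub_C, Multiset.singleton_add]
    obtain ⟨ζ, μ, h1, h2, h3⟩ := ih (f := fun t => f t /ₘ (X - C (r t))) hp'
      (by rw [hroots, Multiset.card_cons] at hd; omega)
      (fun t => natDegree_divByMonic_X_sub_C_le _ (hN t)) (natDegree_divByMonic_X_sub_C_le _ hpN)
      (tendsto_coeff_divByMonic hN hpN hf hra)
    refine ⟨Fin.cons a ζ, Fin.cons r μ, ?_, ?_, ?_⟩
    · rw [hroots, ← h1]; simp [Fin.univ_val_map, List.ofFn_succ]
    · filter_upwards [hr, h2] with t ht ht2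
      have hft : (X - C (r t)) * (f t /ₘ (X - C (r t))) = f t :=
        mul_divByMonic_eq_iff_isRoot.mpr (isRoot_of_mem_roots ht)
      have hft0 : f t ≠ 0 := (mem_roots'.mp ht).1
      have : (f t).roots = r t ::ₘ (f t /ₘ (X - C (r t))).roots := by
        conv_lhs => rw [← hft]
        rw [roots_mul (by rwa [hft]), roots_X_sub_C, Multiset.singleton_add]
      rw [this]
      refine le_trans (le_of_eq ?_) ((Multiset.cons_le_cons_iff (r t)).mpr ht2)
      simp [Fin.univ_val_map, List.ofFn_succ]
    · intro j
      refine Fin.cases ?_ (fun j => ?_) j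
      · simpa using hra
      · simpa using h3 j

end RootContinuity

theorem Multiset.exists_fin_map_le {α : Type*} (s : Multiset α) {d : ℕ} (hd : d ≤ s.card) :
    ∃ x : Fin d → α, Finset.univ.val.map x ≤ s := by
  induction s using Quotient.inductionOn with
  | h l =>
    have hd' : d ≤ l.length := hd
    refine ⟨fun i => l[i], ?_⟩
    have : List.ofFn (fun i : Fin d => l[i]) = l.take d :=
      List.ext_getElem (by simpa using hd') fun i _ _ => by simp
    rw [Fin.univ_val_map, this]
    exact (List.take_sublist d l).subperm

/-- For `τ ≠ 0` the factor `m_A - τ p_{uv}` has the roots of `p_{uv} - τ⁻¹ m_A`, which tends to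
`p_{uv}` coefficientwise. -/
theorem exists_eigenvalues_tendsto_roots_puv {n : ℕ} (A : Matrix (Fin n) (Fin n) ℂ)
    (u v : Fin n → ℂ) (hp : puv A u v ≠ 0) :
    ∃ (ζ : Fin (puv A u v).natDegree → ℂ) (μ : Fin (puv A u v).natDegree → ℂ → ℂ),
      Finset.univ.val.map ζ = (puv A u v).roots ∧
      (∀ τ : ℂ, Finset.univ.val.map (fun j => μ j τ) ≤ (perturbed A u v τ).charpoly.roots) ∧
      ∀ j, Tendsto (μ j) (Bornology.cobounded ℂ) (𝓝 (ζ j)) := by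
  classical
  set p := puv A u v with hpdef
  set m := minpoly ℂ A with hm
  obtain ⟨q, -, hB⟩ := exists_charpoly_perturbed_eq A u v
  have hcard : ∀ τ, (perturbed A u v τ).charpoly.roots.card = n := by
    intro τ
    rw [← (IsAlgClosed.splits _).natDegree_eq_card_roots, Matrix.charpoly_natDegree_eq_dim,
      Fintype.card_fin]
  obtain ⟨ζ, μ, h1, h2, h3⟩ := exists_roots_tendsto (f := fun τ => p - C τ⁻¹ * m)
    (F := Bornology.cobounded ℂ) (N := max p.natDegree m.natDegree) hp
    (IsAlgClosed.splits p).natDegree_eq_card_roots.symm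
    (fun τ => (natDegree_sub_le _ _).trans (max_le_max le_rfl (natDegree_C_mul_le _ _)))
    (le_max_left _ _) (fun i => by
      have := (tendsto_inv₀_cobounded (α := ℂ)).mul_const (m.coeff i)
      simpa using (tendsto_const_nhds (x := p.coeff i)).sub this)
  have hroots : ∀ᶠ τ in Bornology.cobounded ℂ, (Finset.univ.val.map fun j => μ j τ) ≤
      (perturbed A u v τ).charpoly.roots := by
    filter_upwards [h2, Bornology.eventually_ne_cobounded (0 : ℂ)] with τ hτ hτ0
    refine hτ.trans (Multiset.le_iff_exists_add.mpr ⟨q.roots, ?_⟩)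
    have hfac : (perturbed A u v τ).charpoly = C (-τ) * ((p - C τ⁻¹ * m) * q) := by
      rw [hB, ← mul_assoc]
      congr 1
      have : C τ * C τ⁻¹ = (1 : ℂ[X]) := by rw [← C_mul, mul_inv_cancel₀ hτ0, C_1]
      rw [C_neg]
      linear_combination (- m) * this
    have hne := (Matrix.charpoly_monic (perturbed A u v τ)).ne_zero
    rw [hfac] at hne
    rw [hfac, roots_C_mul _ (neg_ne_zero.mpr hτ0), roots_mul (right_ne_zero_of_mul hne)]
  have hpn : p.natDegree ≤ n := by
    obtain ⟨τ, hτ⟩ := hroots.exists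
    have := Multiset.card_le_card hτ
    rw [hcard] at this
    simpa using this
  -- for the remaining `τ`, where no limit is at stake, any eigenvalues will do
  choose x hx using fun τ => Multiset.exists_fin_map_le (perturbed A u v τ).charpoly.roots
    (hpn.trans_eq (hcard τ).symm)
  refine ⟨ζ, fun j τ => if (Finset.univ.val.map fun j => μ j τ) ≤
    (perturbed A u v τ).charpoly.roots then μ j τ else x τ j, h1, fun τ => ?_, fun j => ?_⟩
  · by_cases h : (Finset.univ.val.map fun j => μ j τ) ≤ (perturbed A u v τ).charpoly.roots
    · simpa only [if_pos h] using h
    · simpa only [if_neg h] using hx τ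
  · refine (h3 j).congr' ?_
    filter_upwards [hroots] with τ hτ
    rw [if_pos hτ]

/-! ### Analytic solutions of `y ^ d F y = t ^ d` -/

/-- The substitution `y = t / M t` solves `y ^ d * F y = t ^ d`; it has a left inverse, so that
different `t` give different solutions. -/
theorem exists_analyticAt_pow_eq {F : ℂ → ℂ} (hF : AnalyticAt ℂ F 0) {d : ℕ} (hd : d ≠ 0)
    {γ : ℂ} (hγ : γ ^ d = F 0) (h0 : F 0 ≠ 0) :
    ∃ M Φ : ℂ → ℂ, AnalyticAt ℂ M 0 ∧ M 0 = γ ∧ (∀ᶠ t in 𝓝 0, M t ^ d = F (t / M t)) ∧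
      ∀ᶠ t in 𝓝 0, Φ (t / M t) = t := by
  have hγ0 : γ ≠ 0 := by rintro rfl; simp [hd] at hγ; exact h0 hγ.symm
  have hd' : (d : ℂ) ≠ 0 := Nat.cast_ne_zero.mpr hd
  -- `G` is the branch of `F ^ (1 / d)` with value `γ` at `0`
  set G : ℂ → ℂ := fun y => γ * Complex.exp (Complex.log (F y / F 0) / d) with hG
  have hGan : AnalyticAt ℂ G 0 := by
    refine analyticAt_const.mul (AnalyticAt.cexp ?_)
    refine AnalyticAt.div (AnalyticAt.clog (hF.div analyticAt_const h0) ?_) analyticAt_const hd'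
    rw [div_self h0]
    exact Complex.one_mem_slitPlane
  have hG0 : G 0 = γ := by simp [hG, div_self h0]
  have hGpow : ∀ᶠ y in 𝓝 0, G y ^ d = F y := by
    filter_upwards [hF.continuousAt.eventually_ne h0] with y hy
    rw [hG]
    simp only
    rw [mul_pow, ← Complex.exp_nat_mul, mul_div_cancel₀ _ hd', Complex.exp_log (div_ne_zero hy h0),
      hγ, mul_div_cancel₀ _ h0]
  -- the equation becomes `Φ y = t`, and `y = Ψ t = t / G (Ψ t)`
  set Φ : ℂ → ℂ := fun y => y * G y with hΦ
  have hΦan : AnalyticAt ℂ Φ 0 := analyticAt_id.mul hGan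
  have hΦ0 : Φ 0 = 0 := by simp [hΦ]
  have hΦ' : deriv Φ 0 ≠ 0 := by
    have : HasDerivAt Φ (1 * G 0 + 0 * deriv G 0) 0 :=
      (hasDerivAt_id (0 : ℂ)).mul hGan.differentiableAt.hasDerivAt
    rw [this.deriv, hG0]
    simpa using hγ0
  set Ψ := hΦan.hasStrictDerivAt.localInverse _ _ _ hΦ' with hΨ
  have hΨan : AnalyticAt ℂ Ψ 0 := by simpa only [hΦ0] using hΦan.analyticAt_localInverse hΦ'
  have hinv : ∀ᶠ t in 𝓝 0, Φ (Ψ t) = t := by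
    simpa only [hΦ0] using hΦan.hasStrictDerivAt.eventually_right_inverse hΦ'
  have hΨ0 : Ψ 0 = 0 := by
    have : Ψ (Φ 0) = 0 := HasStrictFDerivAt.localInverse_apply_image ..
    rwa [hΦ0] at this
  have hMan : AnalyticAt ℂ (G ∘ Ψ) 0 := AnalyticAt.comp (by rwa [hΨ0]) hΨan
  have hM0 : (G ∘ Ψ) 0 = γ := by simp [hΨ0, hG0]
  have hdiv : ∀ᶠ t in 𝓝 0, t / (G ∘ Ψ) t = Ψ t := by
    filter_upwards [hinv, hMan.continuousAt.eventually_ne (by rwa [hM0])] with t ht ht0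
    rw [div_eq_iff ht0]
    exact ht.symm
  refine ⟨G ∘ Ψ, Φ, hMan, hM0, ?_, ?_⟩
  · have hΨt : Tendsto Ψ (𝓝 0) (𝓝 0) := by simpa only [hΨ0] using hΨan.continuousAt.tendsto
    filter_upwards [hdiv, hΨt.eventually hGpow] with t h1 h2
    rw [h1]
    exact h2
  · filter_upwards [hdiv, hinv] with t h1 h2
    rw [h1, h2]

section Coefficients

variable {F M : ℂ → ℂ} {d : ℕ} {γ : ℂ}

/-- Logarithmic differentiation of `M ^ d = F (t / M)` frees the equation of powers of `M`. -/
theorem eventually_deriv_eq (hF : AnalyticAt ℂ F 0) (hM : AnalyticAt ℂ M 0) (hM0 : M 0 ≠ 0)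
    (hd : d ≠ 0) (h : ∀ᶠ t in 𝓝 0, M t ^ d = F (t / M t)) :
    ∀ᶠ t in 𝓝 0, d * F (t / M t) * deriv M t =
      deriv F (t / M t) * (1 - t / M t * deriv M t) := by
  have hψ : AnalyticAt ℂ (fun t => t / M t) 0 := analyticAt_id.div hM hM0
  have hψt : Tendsto (fun t => t / M t) (𝓝 0) (𝓝 0) := by
    simpa using hψ.continuousAt.tendsto
  filter_upwards [h.eventually_nhds, hM.eventually_analyticAt, hM.continuousAt.eventually_ne hM0,
    hψt.eventually hF.eventually_analyticAt] with t h1 h2 h3 h4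
  have hMd := h2.differentiableAt.hasDerivAt
  have e1 := hMd.pow d
  have e2 := h4.differentiableAt.hasDerivAt.comp t ((hasDerivAt_id t).div hMd h3)
  have e3 : HasDerivAt (fun t => M t ^ d) _ t := e2.congr_of_eventuallyEq h1
  have e4 := e1.unique e3
  have h5 : M t ^ d = M t ^ (d - 1) * M t := by rw [← pow_succ, Nat.sub_add_cancel (by omega)]
  rw [← h1.self_of_nhds, h5]
  simp only [id] at e4
  have : d * (M t ^ (d - 1) * M t) * deriv M t = M t * (d * M t ^ (d - 1) * deriv M t) := by ring
  rw [this, e4]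
  field_simp

theorem deriv_eq_of_pow_eq (hF : AnalyticAt ℂ F 0) (hM : AnalyticAt ℂ M 0) (hM0 : M 0 = γ)
    (hγ : γ ≠ 0) (hd : d ≠ 0) (h0 : F 0 ≠ 0) (h : ∀ᶠ t in 𝓝 0, M t ^ d = F (t / M t)) :
    deriv M 0 = deriv F 0 / (d * F 0) := by
  have h1 := (eventually_deriv_eq hF hM (by rwa [hM0]) hd h).self_of_nhds
  simp only [zero_div, zero_mul, sub_zero, mul_one] at h1
  rw [eq_div_iff (mul_ne_zero (Nat.cast_ne_zero.mpr hd) h0), ← h1]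
  ring

theorem deriv_deriv_eq_of_pow_eq (hF : AnalyticAt ℂ F 0) (hM : AnalyticAt ℂ M 0) (hM0 : M 0 = γ)
    (hγ : γ ≠ 0) (hd : d ≠ 0) (h0 : F 0 ≠ 0) (h : ∀ᶠ t in 𝓝 0, M t ^ d = F (t / M t)) :
    deriv (deriv M) 0 =
      (deriv (deriv F) 0 - (d + 1) * deriv F 0 * deriv M 0) / (d * F 0 * γ) := by
  have hM0' : M 0 ≠ 0 := by rwa [hM0]
  have h1 := eventually_deriv_eq hF hM hM0' hd h
  have hMd := hM.differentiableAt.hasDerivAt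
  have hψ := (hasDerivAt_id (0 : ℂ)).div hMd hM0'
  have hdM := hM.deriv.differentiableAt.hasDerivAt
  have hψ0 : (id / M : ℂ → ℂ) 0 = 0 := by simp
  have hFd : HasDerivAt F (deriv F 0) ((id / M : ℂ → ℂ) 0) := by
    rw [hψ0]; exact hF.differentiableAt.hasDerivAt
  have hFd' : HasDerivAt (deriv F) (deriv (deriv F) 0) ((id / M : ℂ → ℂ) 0) := by
    rw [hψ0]; exact hF.deriv.differentiableAt.hasDerivAt
  have e1 := ((hFd.comp 0 hψ).const_mul (d : ℂ)).mul hdM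
  have e2 := (hFd'.comp 0 hψ).mul ((hψ.mul hdM).const_sub 1)
  have e3 := e1.unique (e2.congr_of_eventuallyEq h1)
  simp only [Function.comp, Pi.div_apply, id, zero_div, hM0, zero_mul, sub_zero, add_zero,
    one_mul, Pi.mul_apply, mul_one] at e3
  rw [eq_div_iff (mul_ne_zero (mul_ne_zero (Nat.cast_ne_zero.mpr hd) h0) hγ)]
  field_simp at e3
  linear_combination e3

end Coefficients

/-- A function `s ^ e * g (1 / s)` with `g` analytic at `0` has an expansion as in
`IsPuiseuxExpansion`, with the Taylor coefficients of `g`. -/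
theorem isPuiseuxExpansion_of_analyticAt {n : ℕ} {B : ℂ → Matrix (Fin n) (Fin n) ℂ} {d : ℕ}
    (hd : d ≠ 0) (e : ℤ) {g Φ : ℂ → ℂ} (hg : AnalyticAt ℂ g 0)
    (hinj : ∀ᶠ s in Bornology.cobounded ℂ, Φ (s ^ e * g s⁻¹) = s)
    (hroot : ∀ᶠ s in Bornology.cobounded ℂ, (B (s ^ d)).charpoly.IsRoot (s ^ e * g s⁻¹)) :
    IsPuiseuxExpansion B d e (fun m => iteratedDeriv m g 0 / m.factorial)
      (fun s => s ^ e * g s⁻¹) := by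
  have hsum : ∀ᶠ s in Bornology.cobounded ℂ, HasSum
      (fun m : ℕ => iteratedDeriv m g 0 / m.factorial * s ^ (e - (m : ℤ))) (s ^ e * g s⁻¹) := by
    have h1 := hasFPowerSeriesAt_iff.mp hg.hasFPowerSeriesAt
    filter_upwards [tendsto_inv₀_cobounded.eventually h1, Bornology.eventually_ne_cobounded (0 : ℂ)]
      with s hs hs0
    rw [zero_add] at hs
    refine HasSum.congr_fun (hs.mul_left (s ^ e)) fun m => ?_
    rw [FormalMultilinearSeries.coeff_ofScalars, smul_eq_mul, zpow_sub₀ hs0, zpow_natCast, inv_pow]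
    ring
  obtain ⟨R, -, hR⟩ := hasBasis_cobounded_norm.eventually_iff.mp (hsum.and (hinj.and hroot))
  refine ⟨max R 1, by positivity, fun s hs => (hR (le_of_max_le_left hs.le)).1, fun τ hτ => ?_⟩
  have hprim := Complex.isPrimitiveRoot_exp d hd
  have hτ0 : τ ≠ 0 := by
    rintro rfl
    rw [norm_zero] at hτ
    exact hτ.not_ge (by positivity)
  have hmem : ∀ s ∈ nthRoots d τ, s ^ d = τ ∧ R ≤ ‖s‖ := by
    intro s hs
    have hsd := (mem_nthRoots (Nat.pos_of_ne_zero hd)).mp hs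
    refine ⟨hsd, le_of_max_le_left (b := 1) ?_⟩
    rw [← hsd, norm_pow] at hτ
    exact (lt_of_pow_lt_pow_left₀ d (norm_nonneg s) hτ).le
  have hnodup : ((nthRoots d τ).map fun s => s ^ e * g s⁻¹).Nodup := by
    refine Multiset.Nodup.map_on (fun s hs s' hs' h => ?_) (hprim.nthRoots_nodup hτ0)
    rw [← (hR (hmem s hs).2).2.1, ← (hR (hmem s' hs').2).2.1, h]
  refine ⟨?_, hnodup, ?_⟩
  · rw [hprim.card_nthRoots, if_pos (IsAlgClosed.exists_pow_nat_eq τ (Nat.pos_of_ne_zero hd))]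
  · rw [Multiset.le_iff_subset hnodup]
    intro z hz
    obtain ⟨s, hs, rfl⟩ := Multiset.mem_map.mp hz
    rw [mem_roots (Matrix.charpoly_monic _).ne_zero, ← (hmem s hs).1]
    exact (hR (hmem s hs).2).2.2

/-! ### Generating functions of moments -/

/-- The scalar `v^* P (I - y N)⁻¹ u`: near `y = 0`, the generating function of the moments
`v^* P N ^ j u`. The nonsingular inverse is `0` where `I - y N` is singular, so only its germ at
`y = 0` is meaningful. The factor `P` lets the tails of the series be of the same form. -/
noncomputable def momentGen {n : ℕ} (u v : Fin n → ℂ) (P N : Matrix (Fin n) (Fin n) ℂ) (y : ℂ) :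
    ℂ :=
  sesq u v (P * (1 - y • N)⁻¹)

section MomentGen

variable {n : ℕ} (u v : Fin n → ℂ) (P N : Matrix (Fin n) (Fin n) ℂ)

@[simp]
theorem momentGen_zero : momentGen u v P N 0 = sesq u v P := by
  simp [momentGen]

theorem analyticAt_momentGen : AnalyticAt ℂ (momentGen u v P N) 0 := by
  -- analyticity of the inverse needs some complete algebra norm; which one is immaterial
  let := Matrix.linftyOpNormedRing (n := Fin n) (α := ℂ)
  let := Matrix.linftyOpNormedAlgebra (n := Fin n) (R := ℂ) (α := ℂ)
  let φ : Matrix (Fin n) (Fin n) ℂ →ₗ[ℂ] ℂ :=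
    { toFun := fun M => sesq u v (P * M)
      map_add' := fun M M' => by rw [mul_add, sesq_add]
      map_smul' := fun a M => by rw [Matrix.mul_smul, sesq_smul]; rfl }
  have h1 : AnalyticAt ℂ (fun y : ℂ => (1 : Matrix (Fin n) (Fin n) ℂ) - y • N) 0 :=
    analyticAt_const.sub (analyticAt_id.smul analyticAt_const)
  have h2 := (analyticAt_inverse (𝕜 := ℂ) (1 : (Matrix (Fin n) (Fin n) ℂ)ˣ)).comp_of_eq h1
    (by simp)
  have h3 := (φ.toContinuousLinearMap.analyticAt _).comp h2
  refine h3.congr (Eventually.of_forall fun y => ?_)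
  rw [momentGen, Matrix.nonsing_inv_eq_ringInverse]
  rfl

theorem eventually_isUnit_det_one_sub :
    ∀ᶠ y in 𝓝 (0 : ℂ), IsUnit (1 - y • N).det := by
  have hc : Continuous fun y : ℂ => (1 - y • N).det := by fun_prop
  have := hc.continuousAt.eventually_ne (x := 0) (y := 0) (by simp)
  simpa only [isUnit_iff_ne_zero] using this

theorem eventually_momentGen_eq :
    ∀ᶠ y in 𝓝 0, momentGen u v P N y = sesq u v P + y * momentGen u v (P * N) N y := by
  filter_upwards [eventually_isUnit_det_one_sub N] with y hy
  rw [momentGen, momentGen, ← sesq_smul, ← sesq_add]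
  congr 1
  have h := Matrix.mul_nonsing_inv _ hy
  rw [sub_mul, one_mul, sub_eq_iff_eq_add, smul_mul_assoc] at h
  conv_lhs => rw [h]
  rw [mul_add, mul_one, Matrix.mul_smul, mul_assoc]

theorem eventually_deriv_momentGen :
    ∀ᶠ y in 𝓝 0, deriv (momentGen u v P N) y =
      momentGen u v (P * N) N y + y * deriv (momentGen u v (P * N) N) y := by
  filter_upwards [(eventually_momentGen_eq u v P N).eventually_nhds,
    (analyticAt_momentGen u v (P * N) N).eventually_analyticAt] with y h1 h2
  have h3 := ((hasDerivAt_id y).mul h2.differentiableAt.hasDerivAt).const_add (sesq u v P)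
  rw [EventuallyEq.deriv_eq h1]
  simpa using h3.deriv

theorem deriv_momentGen : deriv (momentGen u v P N) 0 = sesq u v (P * N) := by
  simpa using (eventually_deriv_momentGen u v P N).self_of_nhds

theorem deriv_deriv_momentGen :
    deriv (deriv (momentGen u v P N)) 0 = 2 * sesq u v (P * N * N) := by
  have h := analyticAt_momentGen u v (P * N) N
  have h3 := h.differentiableAt.hasDerivAt.add
    ((hasDerivAt_id (0 : ℂ)).mul h.deriv.differentiableAt.hasDerivAt)
  rw [EventuallyEq.deriv_eq (eventually_deriv_momentGen u v P N)]
  refine h3.deriv.trans ?_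
  simp only [deriv_momentGen, id]
  ring

variable {u v P N}

theorem eventually_momentGen_eq_pow_mul {k : ℕ} (h : ∀ j < k, sesq u v (P * N ^ j) = 0) :
    ∀ᶠ y in 𝓝 0, momentGen u v P N y = y ^ k * momentGen u v (P * N ^ k) N y := by
  induction k with
  | zero => simp
  | succ k ih =>
    filter_upwards [ih fun j hj => h j (by omega), eventually_momentGen_eq u v (P * N ^ k) N]
      with y h1 h2
    rw [h1, h2, h k (by omega), mul_assoc P, ← pow_succ]
    ring

/-- The order of vanishing of the generating function at `0` is the index of the first nonzero
moment. -/
theorem moments_of_eventually_eq_pow_mul {k : ℕ} {Q : ℂ → ℂ} (hQ : ContinuousAt Q 0)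
    (h : ∀ᶠ y in 𝓝[≠] 0, momentGen u v P N y = y ^ k * Q y) :
    (∀ j < k, sesq u v (P * N ^ j) = 0) ∧ sesq u v (P * N ^ k) = Q 0 := by
  have hval : ∀ (k : ℕ) (P : Matrix (Fin n) (Fin n) ℂ),
      (∀ᶠ y in 𝓝[≠] 0, momentGen u v P N y = y ^ k * Q y) → sesq u v P = 0 ^ k * Q 0 := by
    intro k P h
    have h1 : Tendsto (momentGen u v P N) (𝓝[≠] 0) (𝓝 (sesq u v P)) := by
      simpa using (analyticAt_momentGen u v P N).continuousAt.tendsto.mono_left nhdsWithin_le_nhds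
    have h2 : Tendsto (fun y => y ^ k * Q y) (𝓝[≠] 0) (𝓝 (0 ^ k * Q 0)) :=
      (((continuous_pow k).continuousAt (x := (0 : ℂ))).mul hQ).tendsto.mono_left
        nhdsWithin_le_nhds
    exact tendsto_nhds_unique h1 (h2.congr' (h.mono fun y hy => hy.symm))
  induction k generalizing P with
  | zero => simpa using hval 0 P h
  | succ k ih =>
    have hP : sesq u v P = 0 := by simpa using hval (k + 1) P h
    have h' : ∀ᶠ y in 𝓝[≠] 0, momentGen u v (P * N) N y = y ^ k * Q y := by
      filter_upwards [h, (eventually_momentGen_eq u v P N).filter_mono nhdsWithin_le_nhds,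
        self_mem_nhdsWithin] with y h1 h2 hy
      rw [h2, hP, zero_add, pow_succ'] at h1
      exact mul_left_cancel₀ hy (by rw [h1]; ring)
    obtain ⟨h1, h2⟩ := ih h'
    refine ⟨fun j hj => ?_, by rw [← h2, pow_succ', ← mul_assoc]⟩
    cases j with
    | zero => simpa using hP
    | succ j => rw [pow_succ', ← mul_assoc]; exact h1 j (by omega)

end MomentGen

/-! ### Expansions of eigenvalues -/

/-- The secular equation: away from the spectrum of `A`, the eigenvalues of `B(τ)` are the
solutions `z` of `τ v^* (z I - A)⁻¹ u = 1`. -/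
theorem isRoot_charpoly_perturbed {n : ℕ} {A : Matrix (Fin n) (Fin n) ℂ} {u v : Fin n → ℂ}
    {τ z : ℂ} (hz : IsUnit (z • (1 : Matrix (Fin n) (Fin n) ℂ) - A).det)
    (h : τ * sesq u v (z • (1 : Matrix (Fin n) (Fin n) ℂ) - A)⁻¹ = 1) :
    (perturbed A u v τ).charpoly.IsRoot z := by
  rw [IsRoot.def, eval_charpoly_perturbed A u v τ hz, h, sub_self, mul_zero]

theorem notMem_spectrum_of_not_isRoot_minpoly {n : ℕ} {A : Matrix (Fin n) (Fin n) ℂ} {z : ℂ}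
    (h : ¬ (minpoly ℂ A).IsRoot z) : z ∉ spectrum ℂ A := by
  intro hz
  have h1 := spectrum.subset_polynomial_aeval A (minpoly ℂ A) ⟨z, hz, rfl⟩
  rw [minpoly.aeval] at h1
  have : Nontrivial (Matrix (Fin n) (Fin n) ℂ) := by
    by_contra hn
    rw [not_nontrivial_iff_subsingleton] at hn
    simp [spectrum.of_subsingleton] at hz
  rw [spectrum.zero_eq] at h1
  exact h h1

theorem iteratedDeriv_two {g : ℂ → ℂ} {x : ℂ} : iteratedDeriv 2 g x = deriv (deriv g) x := by
  rw [iteratedDeriv_succ, iteratedDeriv_one]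

/-- With `z = 1 / y` the secular equation reads `y ^ (κ + 1) F y = 1 / τ`, where `F` is the
generating function of the moments from index `κ` on; its solutions `y = t / M t` with
`t ^ (κ + 1) = 1 / τ` give `z = s M (1 / s)` with `s = 1 / t`. -/
theorem exists_puiseux_at_infinity {n : ℕ} {A : Matrix (Fin n) (Fin n) ℂ} {u v : Fin n → ℂ}
    {κ : ℕ} (h : ∀ j < κ, sesq u v (A ^ j) = 0) (h' : sesq u v (A ^ κ) ≠ 0) {γ : ℂ}
    (hγ : γ ^ (κ + 1) = sesq u v (A ^ κ)) :
    ∃ (c : ℕ → ℂ) (L : ℂ → ℂ),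
      c 0 = γ ∧
      c 1 = 1 / ((κ : ℂ) + 1) * (sesq u v (A ^ (κ + 1)) / sesq u v (A ^ κ)) ∧
      c 2 = 1 / ((κ : ℂ) + 1) * (1 / (sesq u v (A ^ κ) * γ)) *
        (sesq u v (A ^ (κ + 2)) -
          ((κ : ℂ) + 2) / (2 * ((κ : ℂ) + 1)) *
            (sesq u v (A ^ (κ + 1)) ^ 2 / sesq u v (A ^ κ))) ∧
      IsPuiseuxExpansion (perturbed A u v) (κ + 1) 1 c L := by
  have hγ0 : γ ≠ 0 := by rintro rfl; exact h' (by rw [← hγ]; simp)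
  set F := momentGen u v (A ^ κ) A with hFdef
  have hF : AnalyticAt ℂ F 0 := analyticAt_momentGen u v (A ^ κ) A
  have hF0 : F 0 = sesq u v (A ^ κ) := momentGen_zero ..
  have hF1 : deriv F 0 = sesq u v (A ^ (κ + 1)) := by rw [hFdef, deriv_momentGen, ← pow_succ]
  have hF2 : deriv (deriv F) 0 = 2 * sesq u v (A ^ (κ + 2)) := by
    rw [hFdef, deriv_deriv_momentGen, ← pow_succ, ← pow_succ]
  obtain ⟨M, Φ, hM, hM0, hpow, hinj⟩ := exists_analyticAt_pow_eq hF κ.succ_ne_zero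
    (hγ.trans hF0.symm) (by rwa [hF0])
  have hM1 := deriv_eq_of_pow_eq hF hM hM0 hγ0 κ.succ_ne_zero (by rwa [hF0]) hpow
  have hM2 := deriv_deriv_eq_of_pow_eq hF hM hM0 hγ0 κ.succ_ne_zero (by rwa [hF0]) hpow
  have hκ : (κ : ℂ) + 1 ≠ 0 := by exact_mod_cast κ.succ_ne_zero
  rw [hF0, hF1] at hM1
  rw [hF0, hF1, hF2, hM1] at hM2
  push_cast at hM1 hM2
  have hyt : Tendsto (fun t => t / M t) (𝓝 0) (𝓝 0) := by
    have hψ : AnalyticAt ℂ (fun t => t / M t) 0 := analyticAt_id.div hM (by rwa [hM0])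
    simpa using hψ.continuousAt.tendsto
  have hmom : ∀ᶠ y in 𝓝 0, momentGen u v 1 A y = y ^ κ * F y := by
    have := eventually_momentGen_eq_pow_mul (u := u) (v := v) (P := 1) (N := A) (k := κ)
      (by simpa using h)
    simpa using this
  refine ⟨_, _, ?_, ?_, ?_, isPuiseuxExpansion_of_analyticAt κ.succ_ne_zero 1
    (Φ := fun z => (Φ z⁻¹)⁻¹) hM ?_ ?_⟩
  · simp [hM0]
  · simp [hM1]
    field_simp
  · simp [iteratedDeriv_two, hM2]
    field_simp
    ring
  · filter_upwards [tendsto_inv₀_cobounded.eventually hinj] with s hs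
    rw [zpow_one, mul_inv, ← div_eq_mul_inv, hs, inv_inv]
  · filter_upwards [tendsto_inv₀_cobounded.eventually hpow,
      tendsto_inv₀_cobounded.eventually (hyt.eventually hmom),
      tendsto_inv₀_cobounded.eventually (hM.continuousAt.eventually_ne (by rwa [hM0] : M 0 ≠ 0)),
      tendsto_inv₀_cobounded.eventually (hyt.eventually (eventually_isUnit_det_one_sub A)),
      Bornology.eventually_ne_cobounded (0 : ℂ)] with s h1 h2 h3 h4 hs
    rw [zpow_one]
    set y := s⁻¹ / M s⁻¹ with hy
    have hz : s * M s⁻¹ = y⁻¹ := by rw [hy, inv_div, div_inv_eq_mul, mul_comm]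
    have hy0 : y ≠ 0 := div_ne_zero (inv_ne_zero hs) h3
    have hmat : y⁻¹ • (1 : Matrix (Fin n) (Fin n) ℂ) - A = y⁻¹ • (1 - y • A) := by
      rw [smul_sub, smul_smul, inv_mul_cancel₀ hy0, one_smul]
    have hinv : (y⁻¹ • (1 : Matrix (Fin n) (Fin n) ℂ) - A)⁻¹ = y • (1 - y • A)⁻¹ := by
      rw [hmat]
      refine Matrix.inv_eq_left_inv ?_
      rw [smul_mul_smul_comm, mul_inv_cancel₀ hy0, one_smul, Matrix.nonsing_inv_mul _ h4]
    rw [hz]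
    apply isRoot_charpoly_perturbed
    · rw [hmat, Matrix.det_smul]
      exact ((isUnit_iff_ne_zero.mpr (inv_ne_zero hy0)).pow _).mul h4
    · rw [momentGen, one_mul] at h2
      have hsy : s * y * M s⁻¹ = 1 := by
        rw [hy, mul_div_assoc', mul_inv_cancel₀ hs, one_div, inv_mul_cancel₀ h3]
      rw [hinv, sesq_smul, h2, ← h1]
      calc s ^ (κ + 1) * (y * (y ^ κ * M s⁻¹ ^ (κ + 1))) = (s * y * M s⁻¹) ^ (κ + 1) := by ring
        _ = 1 := by rw [hsy, one_pow]

/-- With `z = ζ - w` the secular equation reads `w ^ k F w = 1 / τ`, where `F` is a tail of the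
generating function of the moments of `(ζ I - A)⁻¹`; its solutions are `w = t / M t` with
`t ^ k = 1 / τ`. -/
theorem exists_puiseux_at_root {n : ℕ} {A : Matrix (Fin n) (Fin n) ℂ} {u v : Fin n → ℂ}
    (hp : puv A u v ≠ 0) {ζ : ℂ} {k : ℕ} (hroot : (puv A u v).IsRoot ζ)
    (hk : (puv A u v).rootMultiplicity ζ = k) (hm : ¬ (minpoly ℂ A).IsRoot ζ) {a : ℕ → ℂ}
    (ha : ∀ m, a m = sesq u v ((ζ • (1 : Matrix (Fin n) (Fin n) ℂ) - A)⁻¹ ^ m)) :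
    a (k + 1) ≠ 0 ∧
    ∀ β : ℂ, β ^ k = (a (k + 1))⁻¹ →
      ∃ (b : ℕ → ℂ) (L : ℂ → ℂ),
        b 1 = β ∧
        b 2 = -(1 / (k : ℂ)) * (β ^ 2 * a (k + 2) / a (k + 1)) ∧
        IsPuiseuxExpansion (perturbed A u v) k 0
          (fun m => if m = 0 then ζ else -b m) L ∧
        Tendsto L (Bornology.cobounded ℂ) (𝓝 ζ) := by
  have hk0 : k ≠ 0 := by
    rw [← hk]
    exact ((rootMultiplicity_pos hp).mpr hroot).ne'
  have hkC : (k : ℂ) ≠ 0 := Nat.cast_ne_zero.mpr hk0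
  have hζ := isUnit_det_of_notMem_spectrum (notMem_spectrum_of_not_isRoot_minpoly hm)
  set N := (ζ • (1 : Matrix (Fin n) (Fin n) ℂ) - A)⁻¹ with hN
  have hmat : ∀ w : ℂ, (ζ - w) • (1 : Matrix (Fin n) (Fin n) ℂ) - A =
      (1 - w • N) * (ζ • 1 - A) := by
    intro w
    rw [sub_mul, one_mul, smul_mul_assoc, hN, Matrix.nonsing_inv_mul _ hζ, sub_smul]
    abel
  have hunit : ∀ᶠ w in 𝓝 (0 : ℂ),
      IsUnit ((ζ - w) • (1 : Matrix (Fin n) (Fin n) ℂ) - A).det := by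
    filter_upwards [eventually_isUnit_det_one_sub N] with w hw
    rw [hmat, Matrix.det_mul]
    exact hw.mul hζ
  have hres : ∀ w : ℂ, sesq u v ((ζ - w) • (1 : Matrix (Fin n) (Fin n) ℂ) - A)⁻¹ =
      momentGen u v N N w := by
    intro w
    rw [hmat, Matrix.mul_inv_rev, momentGen, ← hN]
  obtain ⟨q, hq, hqζ⟩ := exists_eq_pow_rootMultiplicity_mul_and_not_dvd _ hp ζ
  rw [hk] at hq
  rw [dvd_iff_isRoot] at hqζ
  -- as `p_{uv} = (X - ζ) ^ k q`, the generating function equals `w ^ k` times the following `Q`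
  obtain ⟨hzero, hfirst⟩ := moments_of_eventually_eq_pow_mul (u := u) (v := v) (P := N) (N := N)
    (k := k) (Q := fun w => (-1) ^ k * q.eval (ζ - w) / (minpoly ℂ A).eval (ζ - w))
    (ContinuousAt.div (by fun_prop) (by fun_prop) (by simpa using hm)) (by
      refine Eventually.filter_mono nhdsWithin_le_nhds ?_
      have hmc : ContinuousAt (fun w => (minpoly ℂ A).eval (ζ - w)) 0 := by fun_prop
      filter_upwards [hmc.eventually_ne (y := 0) (by simpa using hm)] with w h2
      have h3 := puv_eval A u v (ζ - w) (notMem_spectrum_of_not_isRoot_minpoly h2)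
      rw [hres] at h3
      rw [hq] at h3
      simp only [eval_mul, eval_pow, eval_sub, eval_X, eval_C] at h3
      rw [← mul_div_assoc, eq_div_iff h2, mul_comm, ← h3, ← mul_assoc, ← mul_pow]
      ring)
  simp only [← pow_succ', ← ha] at hzero hfirst
  have hak : a (k + 1) ≠ 0 := by
    rw [hfirst, sub_zero]
    exact div_ne_zero (mul_ne_zero (pow_ne_zero _ (by norm_num)) hqζ) hm
  refine ⟨hak, fun β hβ => ?_⟩
  have hβ0 : β ≠ 0 := by rintro rfl; simp [hk0] at hβ; exact hak hβ.symm
  set F := momentGen u v (N ^ (k + 1)) N with hFdef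
  have hF : AnalyticAt ℂ F 0 := analyticAt_momentGen ..
  have hF0 : F 0 = a (k + 1) := by rw [ha]; exact momentGen_zero ..
  have hF1 : deriv F 0 = a (k + 2) := by rw [hFdef, deriv_momentGen, ← pow_succ, ha]
  have hmom : ∀ᶠ w in 𝓝 0, momentGen u v N N w = w ^ k * F w := by
    have := eventually_momentGen_eq_pow_mul (u := u) (v := v) (P := N) (N := N) (k := k)
      (fun j hj => by rw [← pow_succ', ← ha]; exact hzero j hj)
    simpa only [← pow_succ'] using this
  have hγ : β⁻¹ ^ k = F 0 := by rw [inv_pow, hβ, inv_inv, hF0]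
  have hF0' : F 0 ≠ 0 := by rwa [hF0]
  obtain ⟨M, Φ, hM, hM0, hpow, hinj⟩ := exists_analyticAt_pow_eq hF hk0 hγ hF0'
  have hM1 := deriv_eq_of_pow_eq hF hM hM0 (inv_ne_zero hβ0) hk0 hF0' hpow
  rw [hF0, hF1] at hM1
  have hM0' : M 0 ≠ 0 := by rw [hM0]; exact inv_ne_zero hβ0
  have hψ : AnalyticAt ℂ (fun t => t / M t) 0 := analyticAt_id.div hM hM0'
  have hψt : Tendsto (fun t => t / M t) (𝓝 0) (𝓝 0) := by simpa using hψ.continuousAt.tendsto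
  have hg : AnalyticAt ℂ (fun t => ζ - t / M t) 0 := analyticAt_const.sub hψ
  have hg1 : ∀ᶠ t in 𝓝 0, deriv (fun t => ζ - t / M t) t = -((M t - t * deriv M t) / M t ^ 2) := by
    filter_upwards [hM.eventually_analyticAt, hM.continuousAt.eventually_ne hM0'] with t h1 h2
    have := (((hasDerivAt_id t).div h1.differentiableAt.hasDerivAt h2).const_sub ζ).deriv
    simpa using this
  have hg2 : deriv (deriv fun t => ζ - t / M t) 0 = 2 * β ^ 2 * deriv M 0 := by
    rw [EventuallyEq.deriv_eq hg1]
    have hMd := hM.differentiableAt.hasDerivAt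
    have h1 := (((hMd.sub ((hasDerivAt_id (0 : ℂ)).mul hM.deriv.differentiableAt.hasDerivAt)).div
      (hMd.pow 2) (pow_ne_zero 2 hM0')).neg).deriv
    refine h1.trans ?_
    simp [hM0]
    field_simp
  refine ⟨fun m => -(iteratedDeriv m (fun t => ζ - t / M t) 0 / m.factorial),
    fun s => s ^ (0 : ℤ) * (ζ - s⁻¹ / M s⁻¹), ?_, ?_, ?_, ?_⟩
  rotate_left 2
  · convert isPuiseuxExpansion_of_analyticAt hk0 0 hg (Φ := fun z => (Φ (ζ - z))⁻¹) ?_ ?_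
      using 1
    · ext m
      split_ifs with h
      · simp [h]
      · simp
    · filter_upwards [tendsto_inv₀_cobounded.eventually hinj] with s hs
      rw [zpow_zero, one_mul, sub_sub_cancel, hs, inv_inv]
    · filter_upwards [tendsto_inv₀_cobounded.eventually hpow,
        tendsto_inv₀_cobounded.eventually (hψt.eventually hmom),
        tendsto_inv₀_cobounded.eventually (hM.continuousAt.eventually_ne hM0'),
        tendsto_inv₀_cobounded.eventually (hψt.eventually hunit),
        Bornology.eventually_ne_cobounded (0 : ℂ)] with s h1 h2 h3 h4 hs
      rw [zpow_zero, one_mul]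
      apply isRoot_charpoly_perturbed h4
      have hsw : s * (s⁻¹ / M s⁻¹) * M s⁻¹ = 1 := by
        rw [mul_div_assoc', mul_inv_cancel₀ hs, one_div, inv_mul_cancel₀ h3]
      rw [hres, h2, ← h1, ← mul_pow, ← mul_pow, ← mul_assoc, hsw, one_pow]
  · have := hg.continuousAt.tendsto.comp (tendsto_inv₀_cobounded (α := ℂ))
    simpa [Function.comp_def] using this
  · simp [hg1.self_of_nhds, hM0, pow_two]
  · simp only [iteratedDeriv_two, hg2, hM1, Nat.factorial_two, Nat.cast_ofNat]
    field_simp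

theorem theorem1 {n : ℕ} (A : Matrix (Fin n) (Fin n) ℂ) (u v : Fin n → ℂ) (l : ℕ)
    (hl : l = (minpoly ℂ A).natDegree) :
    ((∀ j < l, sesq u v (A ^ j) = 0) →
      puv A u v = 0 ∧ ∀ τ : ℂ, spectrum ℂ (perturbed A u v τ) = spectrum ℂ A) ∧
    (∀ κ < l, (∀ j < κ, sesq u v (A ^ j) = 0) → sesq u v (A ^ κ) ≠ 0 →
      -- (i)
      (puv A u v).degree = ((l - κ - 1 : ℕ) : WithBot ℕ) ∧
      -- (ii)
      (∃ (ζ : Fin (l - κ - 1) → ℂ) (μ : Fin (l - κ - 1) → ℂ → ℂ),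
        Finset.univ.val.map ζ = (puv A u v).roots ∧
        (∀ τ : ℂ, Finset.univ.val.map (fun j => μ j τ) ≤ (perturbed A u v τ).charpoly.roots) ∧
        ∀ j, Tendsto (μ j) (Bornology.cobounded ℂ) (𝓝 (ζ j))) ∧
      -- (iii)
      (∀ γ : ℂ, γ ^ (κ + 1) = sesq u v (A ^ κ) →
        ∃ (c : ℕ → ℂ) (L : ℂ → ℂ),
          c 0 = γ ∧
          c 1 = 1 / ((κ : ℂ) + 1) * (sesq u v (A ^ (κ + 1)) / sesq u v (A ^ κ)) ∧
          c 2 = 1 / ((κ : ℂ) + 1) * (1 / (sesq u v (A ^ κ) * γ)) *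
            (sesq u v (A ^ (κ + 2)) -
              ((κ : ℂ) + 2) / (2 * ((κ : ℂ) + 1)) *
                (sesq u v (A ^ (κ + 1)) ^ 2 / sesq u v (A ^ κ))) ∧
          IsPuiseuxExpansion (perturbed A u v) (κ + 1) 1 c L) ∧
      -- (iv)
      (∀ (ζ : ℂ) (k : ℕ), (puv A u v).IsRoot ζ → (puv A u v).rootMultiplicity ζ = k →
        ¬ (minpoly ℂ A).IsRoot ζ →
        ∀ a : ℕ → ℂ,
          (∀ m, a m = sesq u v ((ζ • (1 : Matrix (Fin n) (Fin n) ℂ) - A)⁻¹ ^ m)) →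
          a (k + 1) ≠ 0 ∧
          ∀ β : ℂ, β ^ k = (a (k + 1))⁻¹ →
            ∃ (b : ℕ → ℂ) (L : ℂ → ℂ),
              b 1 = β ∧
              b 2 = -(1 / (k : ℂ)) * (β ^ 2 * a (k + 2) / a (k + 1)) ∧
              IsPuiseuxExpansion (perturbed A u v) k 0
                (fun m => if m = 0 then ζ else -b m) L ∧
              Tendsto L (Bornology.cobounded ℂ) (𝓝 ζ))) := by
  subst hl
  refine ⟨fun h => ⟨puv_eq_zero h, spectrum_perturbed_of_puv_eq_zero (puv_eq_zero h)⟩,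
    fun κ hκ h h' => ?_⟩
  have hdeg := degree_puv hκ h h'
  have hp : puv A u v ≠ 0 := fun h0 => by simp [h0] at hdeg
  refine ⟨hdeg, ?_, fun γ hγ => exists_puiseux_at_infinity h h' hγ,
    fun ζ k hroot hk hm a ha => exists_puiseux_at_root hp hroot hk hm ha⟩
  rw [← natDegree_eq_of_degree_eq_some hdeg]
  exact exists_eigenvalues_tendsto_roots_puv A u v hp
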